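/- Let $A$ be an AW*-algebra, that is, a C*-algebra such that for every nonempty subset $S\subset A$ there is a projection $p\in A$ (a self-adjoint idempotent) with $\{a\in A : sa=0 \text{ for all } s\in S\}=pA$. Order the projections of $A$ by $e\le f$ if and only if $ef=e$, and let $e\wedge f$ denote the infimum of $e$ and $f$ in this ordered set. Call projections $e$ and $f$ isoclinic with angle $\alpha$, where $0<\alpha<\frac{\pi}{2}$, if $efe=\cos^2\alpha\, e$ and $fef=\cos^2\alpha\, f$. Theorem. Let $e\neq f$ be projections in $A$ with $\|e-f\|<1$ and $e\wedge f=0$. Then there is a projection $g$ in $A$ that is isoclinic to both $e$ and $f$ with the angle $$\alpha=\tfrac12\arcsin\|e-f\|.$$ -/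

import Mathlib

/-- An AW*-algebra: a C*-algebra that is a Baer *-ring, i.e. the right annihilator
`{a | ∀ s ∈ S, s * a = 0}` of every nonempty subset `S` is `e A` for some projection `e`.
(The unit required by `CStarAlgebra` is automatic: take `S = {0}`.) -/
class IsAWStarAlgebra (A : Type*) [CStarAlgebra A] : Prop where
  exists_rightAnnihilator_eq : ∀ S : Set A, S.Nonempty →
    ∃ e : A, IsStarProjection e ∧ {a : A | ∀ s ∈ S, s * a = 0} = {a : A | ∃ b : A, a = e * b}

/-- The set `P(A)` of projections (self-adjoint idempotents) of `A`. -/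
structure StarProj (A : Type*) [CStarAlgebra A] where
  val : A
  isStarProjection : IsStarProjection val

namespace StarProj

variable {A : Type*} [CStarAlgebra A]

instance : CoeOut (StarProj A) A := ⟨StarProj.val⟩

@[ext]
theorem ext {e f : StarProj A} (h : (e : A) = f) : e = f := by
  cases e; cases f; cases h; rfl

instance : Zero (StarProj A) := ⟨⟨0, IsStarProjection.zero A⟩⟩

/-- `P(A)` is ordered by `e ≤ f` if `e f = e`. -/
instance : PartialOrder (StarProj A) where
  le e f := (e : A) * f = e
  le_refl e := e.isStarProjection.isIdempotentElem
  le_trans e f g hef hfg := by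
    change (e : A) * f = e at hef
    change (f : A) * g = f at hfg
    change (e : A) * g = e
    rw [← hef, mul_assoc, hfg]
  le_antisymm e f hef hfe := by
    change (e : A) * f = e at hef
    change (f : A) * e = f at hfe
    apply StarProj.ext
    have h := congrArg star hef
    rw [star_mul, f.isStarProjection.isSelfAdjoint.star_eq,
      e.isStarProjection.isSelfAdjoint.star_eq] at h
    exact h.symm.trans hfe

/-- Two projections `e`, `f` are isoclinic with angle `α`, `0 < α < π / 2`, if
`e f e = cos² α e` and `f e f = cos² α f`. -/
def IsIsoclinic (e f : StarProj A) (α : ℝ) : Prop :=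
  0 < α ∧ α < Real.pi / 2 ∧
    (e : A) * f * e = (Real.cos α ^ 2) • (e : A) ∧
    (f : A) * e * f = (Real.cos α ^ 2) • (f : A)

end StarProj

/-! Treat half the anticommutator of two symmetries as their inner product. The commutator `h = i(ef
- fe)` has a sign `n`, with `n² = p` a projection. Where `h` vanishes, `e` and `f` commute; there
`ef` lies below both, so it is `0`, and `‖e - f‖ < 1` then kills `e` and `f`. Hence both lie under
`p`.

In `pAp` the symmetries `2e - p` and `2f - p` anticommute with `n` and have midpoint `xp`, `x = e +
f - 1`. With `d = (e - f)²`, which commutes with `e` and `f`, `x² = 1 - d` is also the inner product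
of `x` with either symmetry. Put `w = (1 - d)⁻¹` and `c = cos 2α = √(1 - ‖e - f‖²)`. Then `c w x p`
has inner product `c` with both symmetries, and adding `b n` with `b² = 1 - c² w` makes it a
symmetry `u` without changing these products. The root `b` exists because `1 - d ≥ c²`. The
projection is `g = (p + u)/2`, since `cos² α = (1 + c)/2`.

The main lemmas are `exists_sign`, `StarProj.mul_eq_zero_of_commutator_mul_eq_zero`,
`exists_inverse_and_sqrt` and the two bisector identities. -/

/-! ### Algebra of symmetries in a corner. -/

section Symmetries

variable {A : Type*} [Ring A] [Algebra ℝ A]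

/-- If `s`, `t` are symmetries of a corner with unit `p` and `s t + t s = 2 c p`, then the
projections `(p + s) / 2` and `(p + t) / 2` satisfy the compression identity
of isoclinic projections. -/
theorem compress_half_add_symmetry {p s t : A} {c : ℝ} (hp : p * p = p)
    (hps : p * s = s) (hsp : s * p = s) (hpt : p * t = t) (htp : t * p = t)
    (hs : s * s = p) (hst : s * t + t * s = (2 * c) • p) :
    ((2⁻¹ : ℝ) • (p + s)) * ((2⁻¹ : ℝ) • (p + t)) * ((2⁻¹ : ℝ) • (p + s)) =
      ((1 + c) / 2) • ((2⁻¹ : ℝ) • (p + s)) := by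
  have hsts : s * t * s = (2 * c) • s - t := by
    have h1 : s * t = (2 * c) • p - t * s := eq_sub_of_add_eq hst
    rw [h1, sub_mul, smul_mul_assoc, hps, mul_assoc, hs, htp]
  have h2 : (p + s) * (p + t) * (p + s) = (2 * (1 + c)) • (p + s) := by
    have : (p + s) * (p + t) * (p + s) =
        (p * p) * p + p * p * s + (p * t) * p + (p * t) * s + s * p * p + s * p * s
          + (s * t) * p + s * t * s := by noncomm_ring
    rw [this, hsts, mul_assoc s t p, htp, hpt, hsp, hsp, hs, htp, hp, hp, hps,
      eq_sub_of_add_eq hst]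
    module
  rw [smul_mul_smul_comm, smul_mul_smul_comm, h2, smul_smul, smul_smul]
  congr 1
  ring

section Bisector

variable {p n x w b D : A} {c : ℝ}

/-- Pythagoras: the two summands anticommute, so the cross terms cancel, and their squares `c² w p`
and `(1 - c² w) p` add up to `p`. -/
theorem bisector_mul_self (hp : p * p = p) (hnn : n * n = p) (hnp : n * p = n)
    (hpn : p * n = n) (hpx : p * x = x * p) (hnx : n * x = -(x * n)) (hwp : w * p = p * w)
    (hwx : w * x = x * w) (hwn : w * n = n * w) (hwb : w * b = b * w) (hbn : b * n = n * b)
    (hbx : b * x = x * b) (hbp : b * p = p * b) (hwD : w * (x * x) = 1)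
    (hbb : b * b = 1 - c ^ 2 • w) :
    (c • (w * x * p) + b * n) * (c • (w * x * p) + b * n) = p := by
  have h1 : w * x * p * (w * x * p) = w * p := by
    calc w * x * p * (w * x * p) = w * x * (p * w) * x * p := by noncomm_ring
      _ = w * (x * w) * (p * x) * p := by rw [← hwp]; noncomm_ring
      _ = w * (w * (x * x)) * (p * p) := by rw [← hwx, hpx]; noncomm_ring
      _ = w * p := by rw [hwD, hp, mul_one]
  have h2 : w * x * p * (b * n) = w * b * x * n := by
    calc w * x * p * (b * n) = w * x * (p * b) * n := by noncomm_ring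
      _ = w * (x * b) * (p * n) := by rw [← hbp]; noncomm_ring
      _ = w * b * x * n := by rw [← hbx, hpn]; noncomm_ring
  have h3 : b * n * (w * x * p) = -(w * b * x * n) := by
    calc b * n * (w * x * p) = b * (n * w) * x * p := by noncomm_ring
      _ = b * w * (n * x) * p := by rw [← hwn]; noncomm_ring
      _ = -(b * w * x * (n * p)) := by rw [hnx]; noncomm_ring
      _ = -(w * b * x * n) := by rw [hnp, hwb]
  have h4 : b * n * (b * n) = p - c ^ 2 • (w * p) := by
    calc b * n * (b * n) = b * (n * b) * n := by noncomm_ring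
      _ = b * b * (n * n) := by rw [← hbn]; noncomm_ring
      _ = p - c ^ 2 • (w * p) := by rw [hbb, hnn, sub_mul, one_mul, smul_mul_assoc]
  rw [add_mul, mul_add, mul_add, smul_mul_smul_comm, h1, smul_mul_assoc, mul_smul_comm, h2, h3, h4]
  module

/-- Only the component along `x` contributes, because `n` anticommutes with `y`. The factor `w`
normalises the inner product `D` of `x` and `y`. -/
theorem bisector_anticommutator {y : A} (hp : p * p = p) (hnp : n * p = n) (hpn : p * n = n)
    (hpx : p * x = x * p) (hwp : w * p = p * w) (hbp : b * p = p * b) (hpy : p * y = y * p)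
    (hwy : w * y = y * w) (hby : b * y = y * b) (hny : n * y = -(y * n))
    (hxy : x * y + y * x = (2 : ℝ) • D) (hwD : w * D = 1) :
    (c • (w * x * p) + b * n) * (y * p) + y * p * (c • (w * x * p) + b * n) = (2 * c) • p := by
  have h1 : w * x * p * (y * p) = w * (x * y) * p := by
    calc w * x * p * (y * p) = w * x * (p * y) * p := by noncomm_ring
      _ = w * (x * y) * (p * p) := by rw [hpy]; noncomm_ring
      _ = w * (x * y) * p := by rw [hp]
  have h2 : y * p * (w * x * p) = w * (y * x) * p := by
    calc y * p * (w * x * p) = y * (p * w) * x * p := by noncomm_ring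
      _ = (y * w) * (p * x) * p := by rw [← hwp]; noncomm_ring
      _ = w * (y * x) * (p * p) := by rw [← hwy, hpx]; noncomm_ring
      _ = w * (y * x) * p := by rw [hp]
  have h3 : b * n * (y * p) = -(b * y * n) := by
    calc b * n * (y * p) = b * (n * y) * p := by noncomm_ring
      _ = -(b * y * (n * p)) := by rw [hny]; noncomm_ring
      _ = -(b * y * n) := by rw [hnp]
  have h4 : y * p * (b * n) = b * y * n := by
    calc y * p * (b * n) = y * (p * b) * n := by noncomm_ring
      _ = y * b * (p * n) := by rw [← hbp]; noncomm_ring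
      _ = b * y * n := by rw [hpn, hby]
  have h5 : w * (x * y) * p + w * (y * x) * p = (2 : ℝ) • p := by
    rw [← add_mul, ← mul_add, hxy, mul_smul_comm, hwD, smul_mul_assoc, one_mul]
  rw [add_mul, mul_add, smul_mul_assoc, mul_smul_comm, h1, h2, h3, h4, mul_comm, mul_smul, ← h5]
  module

end Bisector

end Symmetries

/-! ### Right projections, signs and functional calculus. -/

section RightProjection

variable {A : Type*} [CStarAlgebra A]

/-- In an AW*-algebra every element has a right projection. -/
theorem exists_rightProjection [IsAWStarAlgebra A] (a : A) :
    ∃ q : A, IsStarProjection q ∧ ∀ b : A, a * b = 0 ↔ q * b = 0 := by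
  obtain ⟨r, hr, hS⟩ := IsAWStarAlgebra.exists_rightAnnihilator_eq ({a} : Set A) ⟨a, rfl⟩
  refine ⟨1 - r, hr.one_sub, fun b => ?_⟩
  have hb : a * b = 0 ↔ ∃ c, b = r * c := by
    simpa using Set.ext_iff.mp hS b
  rw [hb, sub_mul, one_mul, sub_eq_zero]
  constructor
  · rintro ⟨c, rfl⟩
    rw [← mul_assoc, hr.isIdempotentElem.eq]
  · exact fun h => ⟨b, h⟩

/-- Right projections are intertwined by self-adjoint elements that intertwine the elements. -/
theorem rightProjection_intertwine {a₁ a₂ q₁ q₂ y : A}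
    (hq₁ : IsStarProjection q₁) (hq₂ : IsStarProjection q₂)
    (h₁ : ∀ b : A, a₁ * b = 0 ↔ q₁ * b = 0) (h₂ : ∀ b : A, a₂ * b = 0 ↔ q₂ * b = 0)
    (hy : IsSelfAdjoint y) (h₁₂ : a₁ * y = y * a₂) (h₂₁ : a₂ * y = y * a₁) :
    q₁ * y = y * q₂ := by
  -- `a y (1 - q') = y a' (1 - q') = 0` gives half of the relation; the adjoint of the half with
  -- indices exchanged gives `y q₂ = q₁ y q₂`.
  have key : ∀ {a a' q q' : A}, IsStarProjection q' → (∀ b : A, a * b = 0 ↔ q * b = 0) →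
      (∀ b : A, a' * b = 0 ↔ q' * b = 0) → a * y = y * a' → q * y = q * y * q' := by
    intro a a' q q' hq' h h' haa'
    have h0 : a' * (1 - q') = 0 := by
      rw [h', mul_sub, mul_one, hq'.isIdempotentElem.eq, sub_self]
    have h3 : q * (y * (1 - q')) = 0 := by
      rw [← h, ← mul_assoc, haa', mul_assoc, h0, mul_zero]
    rwa [mul_sub, mul_one, mul_sub, ← mul_assoc, sub_eq_zero] at h3
  have e₁ := key hq₂ h₁ h₂ h₁₂
  have e₂ := congrArg star (key hq₁ h₂ h₁ h₂₁)
  simp only [star_mul, hq₁.isSelfAdjoint.star_eq, hq₂.isSelfAdjoint.star_eq, hy.star_eq] at e₂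
  rw [e₁, e₂, mul_assoc]

/-- A self-adjoint element `h` of an AW*-algebra has a sign `n`: a self-adjoint element whose
square is a projection `p` with `h (1 - p) = 0`, such that self-adjoint elements (anti)commuting
with `h` also (anti)commute with `n`. -/
theorem exists_sign [IsAWStarAlgebra A] {h : A} (hh : IsSelfAdjoint h) :
    ∃ n p : A, IsSelfAdjoint n ∧ IsStarProjection p ∧ n * n = p ∧ p * n = n ∧ n * p = n ∧
      h * (1 - p) = 0 ∧
      (∀ y : A, IsSelfAdjoint y → h * y = y * h → n * y = y * n) ∧
      (∀ y : A, IsSelfAdjoint y → h * y = -(y * h) → n * y = -(y * n)) := by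
  set k : A := cfc (fun t : ℝ => |t|) h with hk
  -- As a function of `h²`, `|h|` commutes even with elements that anticommute with `h`.
  have hk' : k = cfc Real.sqrt (h ^ 2) := by
    rw [hk, ← cfc_comp_pow Real.sqrt 2 h]
    exact cfc_congr fun t _ => (Real.sqrt_sq_eq_abs t).symm
  have hksa : IsSelfAdjoint k := cfc_predicate _ _
  have hkk : k * k = h * h := by
    rw [hk, ← cfc_mul (fun t : ℝ => |t|) (fun t : ℝ => |t|) h, ← pow_two h,
      ← cfc_pow_id (R := ℝ) h 2]
    exact cfc_congr fun t _ => by simp [pow_two]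
  have hkcomm : ∀ y : A, Commute (h ^ 2) y → k * y = y * k := fun y hy => by
    rw [hk']
    exact (hy.cfc_real Real.sqrt).eq
  have hkh : k * h = h * k := hkcomm h (Commute.pow_self h 2)
  -- `k + h` and `k - h` are twice the positive and negative parts of `h`; the sign is the
  -- difference of their supports.
  obtain ⟨q₁, hq₁, hz₁⟩ := exists_rightProjection (k + h)
  obtain ⟨q₂, hq₂, hz₂⟩ := exists_rightProjection (k - h)
  have hq₁₂ : q₁ * q₂ = 0 := by
    have h1 : (k + h) * (k - h) = 0 := by
      rw [add_mul, mul_sub, mul_sub, hkk, hkh]; abel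
    have h2 : (k - h) * q₁ = 0 := by
      have := congrArg star ((hz₁ _).mp h1)
      simpa [hksa.star_eq, hh.star_eq, hq₁.isSelfAdjoint.star_eq] using this
    have := congrArg star ((hz₂ _).mp h2)
    simpa [hq₁.isSelfAdjoint.star_eq, hq₂.isSelfAdjoint.star_eq] using this
  have hq₂₁ : q₂ * q₁ = 0 := by
    have := congrArg star hq₁₂
    simpa [hq₁.isSelfAdjoint.star_eq, hq₂.isSelfAdjoint.star_eq] using this
  have i₁ := hq₁.isIdempotentElem.eq
  have i₂ := hq₂.isIdempotentElem.eq
  refine ⟨q₁ - q₂, q₁ + q₂, hq₁.isSelfAdjoint.sub hq₂.isSelfAdjoint, ⟨?_, ?_⟩, ?_, ?_, ?_, ?_,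
    ?_, ?_⟩
  · simp [IsIdempotentElem, mul_add, add_mul, i₁, i₂, hq₁₂, hq₂₁]
  · exact hq₁.isSelfAdjoint.add hq₂.isSelfAdjoint
  · simp [mul_sub, sub_mul, i₁, i₂, hq₁₂, hq₂₁]
  · simp [mul_sub, add_mul, i₁, i₂, hq₁₂, hq₂₁]
  · simp [mul_add, sub_mul, i₁, i₂, hq₁₂, hq₂₁]; abel
  · have h1 : (k + h) * (1 - (q₁ + q₂)) = 0 := by
      rw [hz₁]; simp [mul_sub, mul_add, i₁, hq₁₂]
    have h2 : (k - h) * (1 - (q₁ + q₂)) = 0 := by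
      rw [hz₂]; simp [mul_sub, mul_add, i₂, hq₂₁]
    have h3 : (2 : ℝ) • (h * (1 - (q₁ + q₂))) = 0 := by
      have h4 : (2 : ℝ) • (h * (1 - (q₁ + q₂))) =
          (k + h) * (1 - (q₁ + q₂)) - (k - h) * (1 - (q₁ + q₂)) := by
        rw [two_smul]; noncomm_ring
      rw [h4, h1, h2, sub_zero]
    exact (smul_eq_zero.mp h3).resolve_left two_ne_zero
  · intro y hy hhy
    have hky : k * y = y * k := hkcomm y ((show Commute h y from hhy).pow_left 2)
    have c₁ : q₁ * y = y * q₁ := rightProjection_intertwine hq₁ hq₁ hz₁ hz₁ hy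
      (by rw [add_mul, mul_add, hky, hhy]) (by rw [add_mul, mul_add, hky, hhy])
    have c₂ : q₂ * y = y * q₂ := rightProjection_intertwine hq₂ hq₂ hz₂ hz₂ hy
      (by rw [sub_mul, mul_sub, hky, hhy]) (by rw [sub_mul, mul_sub, hky, hhy])
    rw [sub_mul, mul_sub, c₁, c₂]
  · intro y hy hhy
    have hky : k * y = y * k := by
      refine hkcomm y ?_
      change h ^ 2 * y = y * h ^ 2
      rw [pow_two, mul_assoc, hhy, mul_neg, ← mul_assoc, hhy, neg_mul, neg_neg, mul_assoc]
    -- Anticommuting elements exchange the two parts of `h`, hence their supports.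
    have e₁ : (k + h) * y = y * (k - h) := by
      rw [add_mul, mul_sub, hky, hhy, sub_eq_add_neg]
    have e₂ : (k - h) * y = y * (k + h) := by
      rw [sub_mul, mul_add, hky, hhy, sub_neg_eq_add]
    rw [sub_mul, mul_sub, rightProjection_intertwine hq₁ hq₂ hz₁ hz₂ hy e₁ e₂,
      rightProjection_intertwine hq₂ hq₁ hz₂ hz₁ hy e₂ e₁, neg_sub]

/-- If `d` is self-adjoint with `‖d‖ ≤ 1 - c ^ 2` and `c ≠ 0`, then `1 - d` has an inverse `w`
and `1 - c ^ 2 w` has a square root `b`, both in the bicommutant of `d`. -/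
theorem exists_inverse_and_sqrt {d : A} (hd : IsSelfAdjoint d) {c : ℝ} (hc : c ≠ 0)
    (hdc : ‖d‖ ≤ 1 - c ^ 2) :
    ∃ w b : A, IsSelfAdjoint w ∧ IsSelfAdjoint b ∧ w * (1 - d) = 1 ∧
      b * b = 1 - c ^ 2 • w ∧ w * b = b * w ∧
      ∀ y : A, Commute d y → Commute w y ∧ Commute b y := by
  have hspec : ∀ t ∈ spectrum ℝ d, c ^ 2 ≤ 1 - t := fun t ht => by
    -- The bound of the spectrum by the norm needs `‖1‖ = 1`, so the zero algebra is separate.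
    cases subsingleton_or_nontrivial A
    · simp [spectrum.of_subsingleton] at ht
    have h1 := spectrum.norm_le_norm_of_mem ht
    have h2 := le_abs_self t
    rw [Real.norm_eq_abs] at h1
    linarith
  have hc2 : 0 < c ^ 2 := by positivity
  have hpos : ∀ t ∈ spectrum ℝ d, 1 - t ≠ 0 := fun t ht => (hc2.trans_le (hspec t ht)).ne'
  have cw : ContinuousOn (fun t : ℝ => (1 - t)⁻¹) (spectrum ℝ d) :=
    (by fun_prop : ContinuousOn (fun t : ℝ => 1 - t) (spectrum ℝ d)).inv₀ hpos
  have cb : ContinuousOn (fun t : ℝ => Real.sqrt (1 - c ^ 2 * (1 - t)⁻¹)) (spectrum ℝ d) :=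
    (continuousOn_const.sub (continuousOn_const.mul cw)).sqrt
  refine ⟨cfc (fun t : ℝ => (1 - t)⁻¹) d, cfc (fun t : ℝ => Real.sqrt (1 - c ^ 2 * (1 - t)⁻¹)) d,
    cfc_predicate _ _, cfc_predicate _ _, ?_, ?_, (cfc_commute_cfc _ _ _).eq,
    fun y hy => ⟨hy.cfc_real _, hy.cfc_real _⟩⟩
  · have h1 : (1 : A) - d = cfc (fun t : ℝ => 1 - t) d := by
      rw [cfc_sub (fun _ : ℝ => (1 : ℝ)) (fun t : ℝ => t) d, cfc_const_one ℝ d, cfc_id' ℝ d]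
    rw [h1, ← cfc_mul _ _ d cw, ← cfc_const_one ℝ d]
    exact cfc_congr fun t ht => inv_mul_cancel₀ (hpos t ht)
  · rw [← cfc_mul _ _ d cb cb, ← cfc_const_one ℝ d, ← cfc_smul (c ^ 2) _ d cw,
      ← cfc_sub (fun _ : ℝ => (1 : ℝ)) (fun t : ℝ => c ^ 2 • (1 - t)⁻¹) d continuousOn_const
        (cw.const_smul (c ^ 2))]
    refine cfc_congr fun t ht => ?_
    have h1 := hspec t ht
    have h2 : c ^ 2 * (1 - t)⁻¹ ≤ 1 := by
      rw [← div_eq_mul_inv]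
      exact div_le_one_of_le₀ h1 (hc2.le.trans h1)
    exact Real.mul_self_sqrt (by linarith)

end RightProjection

/-! ### Identities for a pair of projections. -/

section TwoProjections

variable {A : Type*} [CStarAlgebra A]

/-- If the commutator of two projections with zero infimum and distance less than `1` vanishes
on a projection `r` commuting with both, then `e r = 0`. -/
theorem StarProj.mul_eq_zero_of_commutator_mul_eq_zero {e f : StarProj A} {r : A}
    (hnorm : ‖(e : A) - (f : A)‖ < 1) (hinf : IsGLB {e, f} (0 : StarProj A))
    (hr : IsStarProjection r) (her : (e : A) * r = r * e) (hfr : (f : A) * r = r * f)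
    (hcomm : (e : A) * f * r = f * e * r) : (e : A) * r = 0 := by
  have ie := e.isStarProjection.isIdempotentElem.eq
  have jf := f.isStarProjection.isIdempotentElem.eq
  have ir := hr.isIdempotentElem.eq
  have hefr : (e : A) * f * r = 0 := by
    -- On `r` the projections commute, so this product is a projection below both.
    let g : StarProj A := ⟨e * f * r, by
      constructor
      · change (e : A) * f * r * (e * f * r) = e * f * r
        calc (e : A) * f * r * (e * f * r) = e * f * (r * e) * f * r := by noncomm_ring
          _ = e * f * e * (r * f) * r := by rw [← her]; noncomm_ring
          _ = e * (f * e * f) * (r * r) := by rw [← hfr]; noncomm_ring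
          _ = e * f * (e * f * r) := by rw [ir]; noncomm_ring
          _ = e * (f * f) * e * r := by rw [hcomm]; noncomm_ring
          _ = e * (f * e * r) := by rw [jf]; noncomm_ring
          _ = e * e * f * r := by rw [← hcomm]; noncomm_ring
          _ = e * f * r := by rw [ie]
      · change star ((e : A) * f * r) = e * f * r
        rw [star_mul, star_mul, e.isStarProjection.isSelfAdjoint.star_eq,
          f.isStarProjection.isSelfAdjoint.star_eq, hr.isSelfAdjoint.star_eq, hcomm,
          ← mul_assoc, ← hfr, mul_assoc, ← her, ← mul_assoc]⟩
    have hg : g ≤ 0 := by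
      refine hinf.2 ?_
      rintro x (rfl | rfl)
      · change (x : A) * f * r * x = x * f * r
        rw [mul_assoc, ← her, ← mul_assoc, mul_assoc (x : A) f x, mul_assoc, ← hcomm, ← mul_assoc,
          ← mul_assoc, ie]
      · change (e : A) * x * r * x = e * x * r
        rw [mul_assoc, ← hfr, ← mul_assoc, mul_assoc (e : A) x x, jf]
    change (e : A) * f * r * 0 = e * f * r at hg
    rw [← hg, mul_zero]
  -- Left multiplication by the strict contraction `e - f` fixes `e r`, which must therefore vanish.
  have h1 : (e : A) * r = (e - f) * (e * r) := by
    rw [sub_mul, ← mul_assoc, ie, ← mul_assoc, ← hcomm, hefr, sub_zero]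
  have h2 : ‖(e : A) * r‖ ≤ ‖(e : A) - f‖ * ‖(e : A) * r‖ := by
    conv_lhs => rw [h1]
    exact norm_mul_le _ _
  by_contra h3
  have h4 := norm_pos_iff.mpr h3
  nlinarith

/-- The commutator is off-diagonal with respect to `e`, and `2e - 1` acts as `1` and `-1` on the two
blocks. -/
theorem mul_two_smul_sub_one_anticommute {e f : A} (he : e * e = e) :
    (e * f - f * e) * ((2 : ℝ) • e - 1) = -(((2 : ℝ) • e - 1) * (e * f - f * e)) := by
  simp only [two_smul]
  have h : (e * f - f * e) * (e + e - 1) + (e + e - 1) * (e * f - f * e) =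
      (e * e) * f + (e * e) * f - f * (e * e) - f * (e * e) - (e * f + e * f) + (f * e + f * e) := by
    noncomm_ring
  rw [he] at h
  rw [eq_neg_iff_add_eq_zero, h]
  abel

theorem sub_mul_sub_of_idempotent {e f : A} (he : e * e = e) (hf : f * f = f) :
    (e - f) * (e - f) = e - e * f - f * e + f := by
  rw [sub_mul, mul_sub, mul_sub, he, hf]
  abel

theorem commute_sub_mul_sub {e f : A} (he : e * e = e) (hf : f * f = f) :
    Commute ((e - f) * (e - f)) e := by
  change (e - f) * (e - f) * e = e * ((e - f) * (e - f))
  rw [sub_mul_sub_of_idempotent he hf]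
  have h1 : (e - e * f - f * e + f) * e = e * e - e * f * e - f * (e * e) + f * e := by
    noncomm_ring
  have h2 : e * (e - e * f - f * e + f) = e * e - (e * e) * f - e * f * e + e * f := by
    noncomm_ring
  rw [h1, h2, he]
  abel

theorem add_sub_one_mul_self {e f : A} (he : e * e = e) (hf : f * f = f) :
    (e + f - 1) * (e + f - 1) = 1 - (e - f) * (e - f) := by
  have h1 : (e + f - 1) * (e + f - 1) = e * e + e * f + f * e + f * f - e - f - e - f + 1 := by
    noncomm_ring
  rw [sub_mul_sub_of_idempotent he hf, h1, he, hf]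
  abel

theorem add_sub_one_anticommutator {e f : A} (he : e * e = e) (hf : f * f = f) :
    (e + f - 1) * ((2 : ℝ) • e - 1) + ((2 : ℝ) • e - 1) * (e + f - 1) =
      (2 : ℝ) • (1 - (e - f) * (e - f)) := by
  have h1 : (e + f - 1) * (e + e - 1) + (e + e - 1) * (e + f - 1) =
      4 • (e * e) + 2 • (f * e) + 2 • (e * f) - 6 • e - 2 • f + (1 + 1) := by
    noncomm_ring
  simp only [two_smul]
  rw [sub_mul_sub_of_idempotent he hf, h1, he]
  noncomm_ring

end TwoProjections

/-! ### Construction of the isoclinic projection. -/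

theorem mainTheorem7 {A : Type*} [CStarAlgebra A] [IsAWStarAlgebra A]
    (e f : StarProj A) (hne : e ≠ f) (hnorm : ‖(e : A) - (f : A)‖ < 1)
    (hinf : IsGLB {e, f} (0 : StarProj A)) :
    ∃ g : StarProj A,
      StarProj.IsIsoclinic g e (Real.arcsin ‖(e : A) - (f : A)‖ / 2) ∧
      StarProj.IsIsoclinic g f (Real.arcsin ‖(e : A) - (f : A)‖ / 2) := by
  have ie := e.isStarProjection.isIdempotentElem.eq
  have jf := f.isStarProjection.isIdempotentElem.eq
  have se := e.isStarProjection.isSelfAdjoint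
  have sf := f.isStarProjection.isSelfAdjoint
  set s : ℝ := ‖(e : A) - (f : A)‖ with hs
  have hs0 : 0 < s := norm_pos_iff.mpr fun h => hne (StarProj.ext (sub_eq_zero.mp h))
  -- This is `cos 2α`, and `c²` is a lower bound for the spectrum of `1 - (e - f)²`.
  set c : ℝ := Real.sqrt (1 - s ^ 2) with hc
  have hs2 : 0 < 1 - s ^ 2 := by nlinarith
  have hc0 : 0 < c := Real.sqrt_pos.mpr hs2
  have hc2 : c ^ 2 = 1 - s ^ 2 := Real.sq_sqrt hs2.le
  have hcos : Real.cos (Real.arcsin s / 2) ^ 2 = (1 + c) / 2 := by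
    rw [Real.cos_sq, mul_div_cancel₀ _ two_ne_zero, Real.cos_arcsin]
    ring
  have hα0 : 0 < Real.arcsin s / 2 := half_pos (Real.arcsin_pos.mpr hs0)
  have hα1 : Real.arcsin s / 2 < Real.pi / 2 := by
    have := Real.arcsin_le_pi_div_two s
    linarith [Real.pi_pos]
  -- the commutator and its sign
  set h : A := Complex.I • ((e : A) * f - f * e) with hh
  have hsa : IsSelfAdjoint h := by
    change star h = h
    rw [hh, star_smul, star_sub, star_mul, star_mul, se.star_eq, sf.star_eq, Complex.star_def,
      Complex.conj_I, neg_smul, ← smul_neg, neg_sub]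
  obtain ⟨n, p, sn, hp, hnn, hpn, hnp, hhp, hcom, hanti⟩ := exists_sign hsa
  have sp := hp.isSelfAdjoint
  have ip := hp.isIdempotentElem.eq
  have s2 : ∀ {a : A}, IsSelfAdjoint a → IsSelfAdjoint ((2 : ℝ) • a - 1) := fun ha =>
    ((IsSelfAdjoint.all (2 : ℝ)).smul ha).sub (IsSelfAdjoint.one A)
  have hne' : n * ((2 : ℝ) • (e : A) - 1) = -(((2 : ℝ) • (e : A) - 1) * n) := by
    refine hanti _ (s2 se) ?_
    rw [hh, smul_mul_assoc, mul_two_smul_sub_one_anticommute ie, mul_smul_comm, smul_neg]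
  have hnf' : n * ((2 : ℝ) • (f : A) - 1) = -(((2 : ℝ) • (f : A) - 1) * n) := by
    refine hanti _ (s2 sf) ?_
    rw [hh, ← neg_sub ((f : A) * e), smul_mul_assoc, neg_mul,
      mul_two_smul_sub_one_anticommute jf, mul_smul_comm, mul_neg, smul_neg]
  -- Anticommuting with `n` implies commuting with `n² = p`.
  have hp' : ∀ {y : A}, n * y = -(y * n) → p * y = y * p := fun {y} hy => by
    rw [← hnn, mul_assoc, hy, mul_neg, ← mul_assoc, hy, neg_mul, neg_neg, mul_assoc]
  have half : ∀ {a b : A}, b * ((2 : ℝ) • a - 1) = ((2 : ℝ) • a - 1) * b → b * a = a * b := by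
    intro a b hab
    rw [mul_sub, sub_mul, mul_one, one_mul, mul_smul_comm, smul_mul_assoc, sub_left_inj] at hab
    exact smul_right_injective A (two_ne_zero (α := ℝ)) hab
  have hpe : p * e = e * p := half (hp' hne')
  have hpf : p * f = f * p := half (hp' hnf')
  -- both projections lie under `p`
  have hefp : (e : A) * f * (1 - p) = f * e * (1 - p) := by
    rw [← sub_eq_zero, ← sub_mul]
    rw [hh, smul_mul_assoc] at hhp
    exact (smul_eq_zero.mp hhp).resolve_left Complex.I_ne_zero
  have her : (e : A) * (1 - p) = (1 - p) * e := by rw [mul_sub, sub_mul, hpe, mul_one, one_mul]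
  have hfr : (f : A) * (1 - p) = (1 - p) * f := by rw [mul_sub, sub_mul, hpf, mul_one, one_mul]
  have hep : (e : A) * p = e := by
    have := StarProj.mul_eq_zero_of_commutator_mul_eq_zero hnorm hinf hp.one_sub her hfr hefp
    rw [mul_sub, mul_one, sub_eq_zero] at this
    exact this.symm
  have hfp : (f : A) * p = f := by
    have := StarProj.mul_eq_zero_of_commutator_mul_eq_zero (e := f) (f := e)
      (by rw [norm_sub_rev]; exact hnorm) (by rw [Set.pair_comm]; exact hinf) hp.one_sub hfr her
      hefp.symm
    rw [mul_sub, mul_one, sub_eq_zero] at this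
    exact this.symm
  -- the squared operator sine, commuting with both projections
  set d : A := ((e : A) - f) * (e - f) with hd
  have sef : IsSelfAdjoint ((e : A) - f) := IsSelfAdjoint.sub se sf
  have sd : IsSelfAdjoint d := by
    change star d = d
    rw [hd, star_mul, sef.star_eq]
  have hde : Commute d (e : A) := commute_sub_mul_sub ie jf
  have hdf : Commute d (f : A) := by
    have : d = ((f : A) - e) * (f - e) := by rw [hd]; noncomm_ring
    rw [this]
    exact commute_sub_mul_sub jf ie
  have hdh : Commute d h := ((hde.mul_right hdf).sub_right (hdf.mul_right hde)).smul_right _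
  have hdn : Commute d n := (hcom d sd hdh.eq.symm).symm
  have hdp : Commute d p := hnn ▸ hdn.mul_right hdn
  have hdc : ‖d‖ ≤ 1 - c ^ 2 := by
    rw [hc2, sub_sub_cancel, pow_two]
    exact norm_mul_le _ _
  obtain ⟨w, b, sw, sb, hwd, hbb, hwb, hwbcom⟩ := exists_inverse_and_sqrt sd hc0.ne' hdc
  have two_sub_one : ∀ {a y : A}, Commute a y → Commute a ((2 : ℝ) • y - 1) := fun hay =>
    (hay.smul_right _).sub_right (Commute.one_right _)
  -- the bisecting symmetry
  set x : A := e + f - 1 with hx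
  have sx : IsSelfAdjoint x := (IsSelfAdjoint.add se sf).sub (IsSelfAdjoint.one A)
  have hdx : Commute d x := (hde.add_right hdf).sub_right (Commute.one_right _)
  have hpx : p * x = x * p := ((show Commute p (e : A) from hpe).add_right hpf).sub_right
    (Commute.one_right _)
  have hnx : n * x = -(x * n) := by
    have hx2 : (2 : ℝ) • x = ((2 : ℝ) • (e : A) - 1) + ((2 : ℝ) • (f : A) - 1) := by
      rw [hx, smul_sub, smul_add, two_smul ℝ (1 : A)]
      abel
    refine smul_right_injective A (two_ne_zero (α := ℝ)) ?_
    change (2 : ℝ) • (n * x) = (2 : ℝ) • -(x * n)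
    rw [smul_neg, ← mul_smul_comm, ← smul_mul_assoc, hx2, mul_add, add_mul, hne', hnf', neg_add]
  have hwp := (hwbcom p hdp).1.eq
  have hbp := (hwbcom p hdp).2.eq
  have hwx := (hwbcom x hdx).1.eq
  have hwn := (hwbcom n hdn).1.eq
  have hbn := (hwbcom n hdn).2.eq
  set u : A := c • (w * x * p) + b * n with hu
  have huu : u * u = p := bisector_mul_self ip hnn hnp hpn hpx hnx hwp hwx hwn hwb hbn
    (hwbcom x hdx).2.eq hbp (by rw [hx, add_sub_one_mul_self ie jf, hwd]) hbb
  have hup : u * p = u := by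
    rw [hu, add_mul, smul_mul_assoc, mul_assoc (w * x) p p, ip, mul_assoc b n p, hnp]
  have su : IsSelfAdjoint u := by
    change star u = u
    rw [hu, star_add, star_smul, star_trivial, star_mul, star_mul, star_mul, sw.star_eq,
      sx.star_eq, sp.star_eq, sb.star_eq, sn.star_eq, ← hbn, ← hwx, ← mul_assoc, ← hwp, mul_assoc,
      hpx, ← mul_assoc]
  have hpu : p * u = u := by
    have := congrArg star hup
    rwa [star_mul, su.star_eq, sp.star_eq] at this
  let g : StarProj A := ⟨(2⁻¹ : ℝ) • (p + u), by
    constructor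
    · change (2⁻¹ : ℝ) • (p + u) * (2⁻¹ : ℝ) • (p + u) = (2⁻¹ : ℝ) • (p + u)
      rw [smul_mul_smul_comm, mul_add, add_mul p u p, add_mul p u u, ip, hpu, hup, huu]
      module
    · exact (IsSelfAdjoint.all (2⁻¹ : ℝ)).smul (IsSelfAdjoint.add sp su)⟩
  -- The construction of `u` is symmetric in `e` and `f`, so one argument serves both.
  have iso : ∀ a : StarProj A, (a : A) * p = a → p * a = a * p → Commute d (a : A) →
      n * ((2 : ℝ) • (a : A) - 1) = -(((2 : ℝ) • (a : A) - 1) * n) →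
      x * ((2 : ℝ) • (a : A) - 1) + ((2 : ℝ) • (a : A) - 1) * x = (2 : ℝ) • (1 - d) →
      StarProj.IsIsoclinic g a (Real.arcsin s / 2) := by
    intro a hap hpa hda hna hxa
    have ia := a.isStarProjection.isIdempotentElem.eq
    have hda' := hwbcom _ (two_sub_one hda)
    have hut := bisector_anticommutator (c := c) ip hnp hpn hpx hwp hbp (hp' hna) hda'.1.eq
      hda'.2.eq hna hxa hwd
    have ht : ((2 : ℝ) • (a : A) - 1) * p = (2 : ℝ) • (a : A) - p := by
      rw [sub_mul, smul_mul_assoc, hap, one_mul]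
    rw [ht, ← hu] at hut
    have htp : ((2 : ℝ) • (a : A) - p) * p = (2 : ℝ) • (a : A) - p := by
      rw [sub_mul, smul_mul_assoc, hap, ip]
    have hpt : p * ((2 : ℝ) • (a : A) - p) = (2 : ℝ) • (a : A) - p := by
      rw [mul_sub, mul_smul_comm, hpa, hap, ip]
    have htt : ((2 : ℝ) • (a : A) - p) * ((2 : ℝ) • (a : A) - p) = p := by
      rw [mul_sub, htp, mul_smul_comm, sub_mul, smul_mul_assoc, ia, hpa, hap]
      module
    -- This puts `a` in the same form as `g`, with symmetry `2a - p` in place of `u`.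
    have ha : (a : A) = (2⁻¹ : ℝ) • (p + ((2 : ℝ) • (a : A) - p)) := by module
    have h1 := compress_half_add_symmetry ip hpu hup hpt htp huu hut
    have h2 := compress_half_add_symmetry ip hpt htp hpu hup htt ((add_comm _ _).trans hut)
    rw [← ha] at h1 h2
    refine ⟨hα0, hα1, ?_, ?_⟩
    · rw [hcos]; exact h1
    · rw [hcos]; exact h2
  refine ⟨g, iso e hep hpe hde hne' (add_sub_one_anticommutator ie jf),
    iso f hfp hpf hdf hnf' ?_⟩
  have h1 := add_sub_one_anticommutator jf ie
  rwa [add_comm (f : A) e, ← neg_sub (e : A) f, neg_mul_neg] at h1
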